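/- For an open bounded convex set $K\subset\mathbb R^n$, $n\ge 1$, and distinct points $p,q\in K$, the Funk distance is $d_K(p,q)=\log\frac{|p-b|}{|q-b|}$, where $b$ is the point at which the half-line from $p$ through $q$ meets $\partial K$, and $d_K(p,p)=0$. Let $B_K(p,R)=\{z\in K: d_K(p,z)\le R\}$ be the forward ball, $K^p=\{\xi\in\mathbb R^n:\langle \xi,x-p\rangle\le 1\text{ for all }x\in K\}$ the polar of $K$ with respect to $p$, $|\cdot|$ Lebesgue measure, $\omega_n$ the volume of the Euclidean unit ball of $\mathbb R^n$, and $\mathrm{vol}_K(U)=\frac1{\omega_n}\int_U|K^p|\,dp$ the Holmes--Thompson volume of a Borel set $U\subset K$ in the Funk geometry of $K$. Let $\Delta_n=\{x\in\mathbb R^n: x_1,\dots,x_n>0,\ x_1+\dots+x_n<1\}$ be the standard simplex, $\Delta_n(R)$ its forward ball of radius $R$ centered at its barycenter $\left(\frac1{n+1},\dots,\frac1{n+1}\right)$, and $V_{\Delta_n}(R)=\omega_n\,\mathrm{vol}_{\Delta_n}(\Delta_n(R))$. Then, for every $n\ge1$ and $R>0$, $V_{\Delta_n}(R)$ is finite,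 the forward ball of radius $R$ centered at the barycenter of any nondegenerate open simplex in $\mathbb R^n$ has Holmes--Thompson volume $\frac1{\omega_n}V_{\Delta_n}(R)$ in the Funk geometry of that simplex, and $$V_{\Delta_n}(R)=\frac{n+1}{n!}\int_{\Delta_n(R)}\frac{dx_1\cdots dx_n}{x_1\cdots x_n},$$ the integral being finite. For $n\ge2$ and $R>0$, $V_{\Delta_n}$ is differentiable at $R$ and $$V'_{\Delta_n}(R)=\frac{n+1}{n}\,\frac{1}{1-\frac{e^{-R}}{n+1}}\,V_{\Delta_{n-1}}\!\left(R+\log\left(1+\frac1n-\frac1n e^{-R}\right)\right).$$ For every $n\ge 1$, $$V_{\Delta_n}(R)=\frac{(n+1)!}{(n!)^2}R^n\left(1+n\log(n+1)R^{-1}+o(R^{-1})\right)\qquad (R\to\infty),$$ $$V_{\Delta_n}(R)=\frac{(n+1)^{n+1}}{(n!)^2}\left(R^n-\frac n2R^{n+1}+o(R^{n+1})\right)\qquad (R\to0^+).$$ -/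

import Mathlib

open MeasureTheory Filter Topology Asymptotics

noncomputable section

namespace FunkSimplex

/-- `ℝⁿ` with its Euclidean structure and Lebesgue measure. -/
abbrev E (n : ℕ) : Type := EuclideanSpace ℝ (Fin n)

/-- For an open bounded convex set `K`, a point `p ∈ K` and `v ≠ 0`, this is the unique `t > 0`
with `p + t v ∈ ∂K`. -/
def exitTime {n : ℕ} (K : Set (E n)) (p v : E n) : ℝ :=
  sInf {t : ℝ | 0 < t ∧ p + t • v ∈ frontier K}

/-- The point where the half-line from `p` through `q` meets `∂K`. -/
def exitPoint {n : ℕ} (K : Set (E n)) (p q : E n) : E n :=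
  p + exitTime K p (q - p) • (q - p)

open Classical in
/-- The Funk (weak) distance `log (pb / qb)`, where `b` is the point at which the half-line
from `p` through `q` meets `∂K`; it vanishes for `p = q`. -/
def funkDist {n : ℕ} (K : Set (E n)) (p q : E n) : ℝ :=
  if p = q then 0
  else Real.log (dist p (exitPoint K p q) / dist q (exitPoint K p q))

/-- The forward Funk ball with center `p` and radius `R`. -/
def funkBall {n : ℕ} (K : Set (E n)) (p : E n) (R : ℝ) : Set (E n) :=
  {z | z ∈ K ∧ funkDist K p z ≤ R}

/-- The (one-sided) polar `(K - p)°` of `K` with respect to `p`, the dual of `ℝⁿ` being identified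
with `ℝⁿ` through the standard coordinates. -/
def polarAt {n : ℕ} (K : Set (E n)) (p : E n) : Set (E n) :=
  {ξ | ∀ x ∈ K, inner ℝ ξ (x - p) ≤ 1}

/-- The volume `ω_n` of the Euclidean unit ball. -/
def unitBallVolume (n : ℕ) : ENNReal := volume (Metric.ball (0 : E n) 1)

/-- The Holmes--Thompson volume of `U ⊆ K` in the Funk geometry of `K`. -/
def holmesThompson {n : ℕ} (K U : Set (E n)) : ENNReal :=
  ∫⁻ p in U, volume (polarAt K p) / unitBallVolume n

/-- The standard open simplex, the interior of the convex hull of `0, e_1, …, e_n`. -/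
def stdSimplex (n : ℕ) : Set (E n) :=
  {x | (∀ i, 0 < x i) ∧ ∑ i, x i < 1}

/-- The barycenter of the standard simplex. -/
def stdBarycenter (n : ℕ) : E n :=
  WithLp.toLp 2 (fun _ => 1 / ((n : ℝ) + 1))

/-- The forward Funk ball `Δ_n(R)` of the standard simplex around its barycenter. -/
def simplexBall (n : ℕ) (R : ℝ) : Set (E n) :=
  funkBall (stdSimplex n) (stdBarycenter n) R

/-- `V_{Δ_n}(R)`: the Holmes--Thompson volume of `Δ_n(R)` multiplied by `ω_n`. -/
def simplexVolume (n : ℕ) (R : ℝ) : ℝ :=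
  (unitBallVolume n * holmesThompson (stdSimplex n) (simplexBall n R)).toReal

end FunkSimplex

end
noncomputable section

namespace FunkSimplex

/-!
The Funk ball of radius `R` around `p` is the image of `closure K` under the homothety with center
`p` and ratio `1 - e^{-R}`. Around the barycenter of the standard simplex it therefore consists of
the points whose barycentric coordinates `x₀ = 1 - ∑ xᵢ, x₁, …, xₙ` are all at least
`c = e^{-R} / (n + 1)`. The polar of the simplex at `x` is the image of a simplex under a linear map
of determinant `1 / (x₀ ⋯ xₙ)`. As `x₀ + ⋯ + xₙ = 1`, the function `1 / (x₀ ⋯ xₙ)` is a sum of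
`n + 1` terms `∏_{j ≠ i} 1 / xⱼ`, which have equal integrals by symmetry: this is the integral
formula.

In terms of convolutions, let `w` be `1 / t` truncated to `[c, ∞)` and `χ` the indicator function of
`[c, ∞)`. Multiplication by `t` is a derivation of the convolution product, so `t w = χ` gives
`t (w ⋆ ⋯ ⋆ w) = (n + 1) (w ⋆ ⋯ ⋆ w ⋆ χ)`, with `n + 1` factors on each side. Since convolution with
`χ` is integration, the integral `Iₙ = w ⋆ ⋯ ⋆ w ⋆ χ` (`n` factors `w`) satisfies
`Iₙ₊₁(S) = ∫ (n + 1) / t * Iₙ(t) dt` over `t ≤ S - c`, which is the recursive differential equation.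
Both asymptotic expansions follow by induction from integrating this equation.
-/

/-! ### Comparing functions and their derivatives -/

lemma isLittleO_atTop_of_deriv {F : Type*} [NormedAddCommGroup F] [NormedSpace ℝ F]
    {f f' : ℝ → F} {g g' : ℝ → ℝ} (hf : ∀ᶠ x in atTop, HasDerivAt f (f' x) x)
    (hg : ∀ᶠ x in atTop, HasDerivAt g (g' x) x) (hg' : ∀ᶠ x in atTop, 0 ≤ g' x)
    (htop : Tendsto g atTop atTop) (h : f' =o[atTop] g') : f =o[atTop] g := by
  refine isLittleO_iff.2 fun ε hε => ?_
  obtain ⟨a, ha⟩ := eventually_atTop.1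
    (hf.and (hg.and (hg'.and (isLittleO_iff.1 h (half_pos hε)))))
  have increment_le (b : ℝ) (hab : a ≤ b) : ‖f b - f a‖ ≤ ε / 2 * (g b - g a) := by
    have hF (x : ℝ) (hx : a ≤ x) := (ha x hx).1.sub_const (f a)
    have hG (x : ℝ) (hx : a ≤ x) := ((ha x hx).2.1.sub_const (g a)).const_mul (ε / 2)
    refine image_norm_le_of_norm_deriv_right_le_deriv_boundary'
      (fun x hx => (hF x hx.1).continuousAt.continuousWithinAt)
      (fun x hx => (hF x hx.1).hasDerivWithinAt) (by simp)
      (fun x hx => (hG x hx.1).continuousAt.continuousWithinAt)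
      (fun x hx => (hG x hx.1).hasDerivWithinAt) (fun x hx => ?_) ⟨hab, le_rfl⟩
    obtain ⟨-, -, hpos, hle⟩ := ha x hx.1
    rwa [Real.norm_of_nonneg hpos] at hle
  filter_upwards [eventually_ge_atTop a, htop.eventually_ge_atTop 0,
    (htop.const_mul_atTop (half_pos hε)).eventually_ge_atTop (‖f a‖ - ε / 2 * g a)]
    with b hab hb hb'
  rw [Real.norm_of_nonneg hb]
  linarith [increment_le b hab, norm_le_norm_sub_add (f b) (f a)]

lemma isLittleO_pow_nhdsGT_zero_of_deriv {f f' : ℝ → ℝ} {k : ℕ}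
    (hf : ∀ᶠ x in 𝓝[>] 0, HasDerivAt f (f' x) x) (h0 : Tendsto f (𝓝[>] 0) (𝓝 0))
    (h : f' =o[𝓝[>] 0] fun x => x ^ k) : f =o[𝓝[>] 0] fun x => x ^ (k + 1) := by
  have hpos : ∀ᶠ x : ℝ in 𝓝[>] 0, 0 < x := self_mem_nhdsWithin
  rw [isLittleO_iff_tendsto' (hpos.mono fun x hx h' => absurd h' (by positivity))]
  refine HasDerivAt.lhopital_zero_nhdsGT hf (.of_forall fun x => hasDerivAt_pow (k + 1) x)
    (hpos.mono fun x hx => by positivity) h0 ?_ ?_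
  · simpa using ((continuous_pow (M := ℝ) (k + 1)).tendsto 0).mono_left nhdsWithin_le_nhds
  · exact (h.const_mul_right (by positivity : ((k + 1 : ℕ) : ℝ) ≠ 0)).tendsto_div_nhds_zero

lemma isLittleO_pow_sub_pow {ι 𝕜 : Type*} [NormedField 𝕜] {l : Filter ι} {a b d : ι → 𝕜}
    (hab : a ~[l] b) (hd : (a - b) ~[l] d) (k : ℕ) :
    (fun x => a x ^ k - b x ^ k - k * b x ^ (k - 1) * d x) =o[l]
      fun x => b x ^ (k - 1) * d x := by
  have hsum : (fun x => ∑ i ∈ Finset.range k, (a x ^ i * b x ^ (k - 1 - i) - b x ^ (k - 1)))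
      =o[l] fun x => b x ^ (k - 1) := by
    refine IsLittleO.fun_sum fun i hi => ?_
    refine ((hab.pow i).mul (IsEquivalent.refl (u := fun x => b x ^ (k - 1 - i)))).isLittleO.congr
      (fun x => ?_) fun x => ?_ <;>
    simp only [Pi.mul_apply, Pi.pow_apply, Pi.sub_apply, ← pow_add,
      Nat.add_sub_cancel' (Nat.le_sub_one_of_lt (Finset.mem_range.1 hi))]
  refine ((hsum.mul_isBigO hd.isBigO).add
    (((isBigO_refl (fun x => b x ^ (k - 1)) l).const_mul_left (k : 𝕜)).mul_isLittleO
      hd.isLittleO)).congr_left fun x => ?_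
  simp only [Pi.sub_apply, Finset.sum_sub_distrib, Finset.sum_const, Finset.card_range,
    nsmul_eq_mul, ← geom_sum₂_mul (a x) (b x) k]
  ring

lemma hasDerivAt_integral_of_continuousOn {F : Type*} [NormedAddCommGroup F] [NormedSpace ℝ F]
    [CompleteSpace F] {f : ℝ → F} {s : Set ℝ} [s.OrdConnected] (hs : IsOpen s)
    (hf : ContinuousOn f s) {a x : ℝ} (ha : a ∈ s) (hx : x ∈ s) :
    HasDerivAt (fun u => ∫ t in a..u, f t) (f x) x :=
  intervalIntegral.integral_hasDerivAt_right
    (hf.mono (Set.OrdConnected.uIcc_subset ‹_› ha hx)).intervalIntegrable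
    (hf.stronglyMeasurableAtFilter hs x hx) (hf.continuousAt (hs.mem_nhds hx))

/-! ### The volume profile -/

/-- The volume profile of Funk balls of the simplex: `V_{Δ_n}(R) = (n + 1) / n! * profile n τ` for
`τ = (n + 1) * (exp R - 1)`. In the parameter `τ` the recursive differential equation has no
shift. -/
def profile : ℕ → ℝ → ℝ
  | 0, _ => 1
  | n + 1, τ => ∫ t in (0 : ℝ)..τ, ((n : ℝ) + 1) / (n + 1 + t) * profile n t

lemma continuousOn_profile_integrand {n : ℕ} (h : ContinuousOn (profile n) (Set.Ioi (-1))) :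
    ContinuousOn (fun t => ((n : ℝ) + 1) / (n + 1 + t) * profile n t) (Set.Ioi (-1)) := by
  refine (continuousOn_const.div (by fun_prop) fun t (ht : -1 < t) => ?_).mul h
  linarith [n.cast_nonneg (α := ℝ)]

lemma continuousOn_profile (n : ℕ) : ContinuousOn (profile n) (Set.Ioi (-1)) := by
  induction n with
  | zero => exact continuousOn_const
  | succ n ih => exact fun τ hτ => (hasDerivAt_integral_of_continuousOn isOpen_Ioi
      (continuousOn_profile_integrand ih) (by simp) hτ).continuousAt.continuousWithinAt

lemma hasDerivAt_profile (n : ℕ) {τ : ℝ} (hτ : -1 < τ) :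
    HasDerivAt (profile (n + 1)) (((n : ℝ) + 1) / (n + 1 + τ) * profile n τ) τ :=
  hasDerivAt_integral_of_continuousOn isOpen_Ioi
    (continuousOn_profile_integrand (continuousOn_profile n)) (by simp) hτ

lemma continuousAt_profile_zero (n : ℕ) : ContinuousAt (profile n) 0 :=
  (continuousOn_profile n).continuousAt (isOpen_Ioi.mem_nhds (by simp))

lemma profile_succ_zero (n : ℕ) : profile (n + 1) 0 = 0 := by
  simp [profile]

lemma profile_nonneg (n : ℕ) {τ : ℝ} (hτ : 0 ≤ τ) : 0 ≤ profile n τ := by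
  induction n generalizing τ with
  | zero => exact zero_le_one
  | succ n ih =>
    exact intervalIntegral.integral_nonneg hτ fun t ht => mul_nonneg
      (div_nonneg (by positivity) (by linarith [ht.1, n.cast_nonneg (α := ℝ)])) (ih ht.1)

lemma profile_one {τ : ℝ} (hτ : 0 ≤ τ) : profile 1 τ = Real.log (1 + τ) := by
  have h := intervalIntegral.integral_comp_add_left (a := 0) (b := τ) (fun t : ℝ => 1 / t) 1
  rw [integral_one_div_of_pos (by simp) (by linarith)] at h
  simpa [profile] using h

lemma profile_isLittleO_nhdsGT_zero (n : ℕ) :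
    (fun τ => profile n τ - (τ ^ n - (n : ℝ) / (n + 1) * τ ^ (n + 1)) / n.factorial)
      =o[𝓝[>] 0] fun τ => τ ^ (n + 1) := by
  induction n with
  | zero => simp [profile]
  | succ n ih =>
    have hpos : ∀ᶠ τ : ℝ in 𝓝[>] 0, 0 < τ := self_mem_nhdsWithin
    refine isLittleO_pow_nhdsGT_zero_of_deriv (f' := fun τ =>
      ((n : ℝ) + 1) / (n + 1 + τ) * profile n τ - (τ ^ n - τ ^ (n + 1)) / n.factorial)
      (hpos.mono fun τ hτ => ?_) ?_ ?_
    · refine ((hasDerivAt_profile n (by linarith)).sub (((hasDerivAt_pow (n + 1) τ).sub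
        ((hasDerivAt_pow (n + 2) τ).const_mul _)).div_const _)).congr_deriv ?_
      push_cast [Nat.factorial_succ]
      field_simp
      ring
    · have hcont : ContinuousAt (fun τ => profile (n + 1) τ - (τ ^ (n + 1) -
          ((n + 1 : ℕ) : ℝ) / ((n + 1 : ℕ) + 1) * τ ^ (n + 1 + 1)) / (n + 1).factorial) 0 :=
        (continuousAt_profile_zero (n + 1)).sub (by fun_prop)
      simpa [profile_succ_zero] using hcont.tendsto.mono_left nhdsWithin_le_nhds
    · have hbdd (k : ℝ) : (fun τ : ℝ => k / (n + 1 + τ)) =O[𝓝[>] 0] fun _ => (1 : ℝ) := by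
        have hcont : ContinuousAt (fun τ : ℝ => k / (n + 1 + τ)) 0 :=
          continuousAt_const.div (by fun_prop) (by positivity)
        exact (hcont.tendsto.isBigO_one ℝ).mono nhdsWithin_le_nhds
      have hrem : (fun τ : ℝ => τ ^ (n + 2)) =o[𝓝[>] 0] fun τ => τ ^ (n + 1) :=
        (isLittleO_pow_pow (by omega)).mono nhdsWithin_le_nhds
      refine (((hbdd (n + 1)).mul_isLittleO ih).add
        ((hbdd (1 / n.factorial)).mul_isLittleO hrem)).congr' (hpos.mono fun τ hτ => ?_)
        (by simp)
      field_simp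
      ring

lemma profile_one_exp_sub_isLittleO :
    (fun s : ℝ => profile 1 (Real.exp s) - s) =o[atTop] fun _ => (1 : ℝ) := by
  have h : Tendsto (fun s : ℝ => Real.log (1 + Real.exp (-s))) atTop (𝓝 (Real.log (1 + 0))) :=
    (tendsto_const_nhds.add Real.tendsto_exp_neg_atTop_nhds_zero).log (by norm_num)
  rw [add_zero, Real.log_one] at h
  refine (isLittleO_one_iff ℝ).2 (h.congr fun s => ?_)
  rw [profile_one (Real.exp_pos s).le, eq_sub_iff_add_eq]
  nth_rewrite 2 [← Real.log_exp s]
  rw [← Real.log_mul (by positivity) (by positivity), add_mul, ← Real.exp_add]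
  simp [add_comm]

lemma mul_profile_exp_isLittleO {n : ℕ} {k : ℝ} (hk : 0 < k)
    (h : (fun s : ℝ => profile (n + 1) (Real.exp s)) =O[atTop] fun s => s ^ (n + 1)) :
    (fun s : ℝ => k / (k + Real.exp s) * profile (n + 1) (Real.exp s)) =o[atTop]
      fun s => s ^ n := by
  have hcoeff : (fun s : ℝ => k / (k + Real.exp s)) =O[atTop] fun s => Real.exp (-s) := by
    refine IsBigO.of_bound k (.of_forall fun s => ?_)
    rw [Real.norm_of_nonneg (by positivity), Real.norm_of_nonneg (by positivity),
      Real.exp_neg, ← div_eq_mul_inv]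
    gcongr
    linarith
  have hexp : (fun s : ℝ => Real.exp (-s) * s) =o[atTop] fun _ => (1 : ℝ) := by
    rw [isLittleO_one_iff]
    simpa [mul_comm] using Real.tendsto_pow_mul_exp_neg_atTop_nhds_zero 1
  refine (hcoeff.mul h).trans_isLittleO ?_
  simpa [pow_succ', mul_assoc] using hexp.mul_isBigO (isBigO_refl (fun s : ℝ => s ^ n) atTop)

lemma profile_exp_sub_pow_isLittleO (n : ℕ) :
    (fun s : ℝ => profile (n + 1) (Real.exp s) - s ^ (n + 1)) =o[atTop] fun s => s ^ n := by
  induction n with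
  | zero => simpa using profile_one_exp_sub_isLittleO
  | succ n ih =>
    set k : ℝ := ((n + 1 : ℕ) : ℝ) + 1 with hk
    have hk_pos : 0 < k := by positivity
    have hO : (fun s : ℝ => profile (n + 1) (Real.exp s)) =O[atTop] fun s => s ^ (n + 1) := by
      simpa using (ih.isBigO.trans (isLittleO_pow_pow_atTop_of_lt n.lt_succ_self).isBigO).add
        (isBigO_refl (fun s : ℝ => s ^ (n + 1)) atTop)
    refine isLittleO_atTop_of_deriv (f' := fun s => k / (k + Real.exp s) *
        profile (n + 1) (Real.exp s) * Real.exp s - ((n + 2 : ℕ) : ℝ) * s ^ (n + 1))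
      (g' := fun s => ((n + 1 : ℕ) : ℝ) * s ^ n) (.of_forall fun s => ?_)
      (.of_forall fun s => hasDerivAt_pow (n + 1) s)
      ((eventually_ge_atTop 0).mono fun s hs => by positivity) (tendsto_pow_atTop (by omega)) ?_
    · exact ((hasDerivAt_profile (n + 1) (by linarith [Real.exp_pos s])).comp s
        (Real.hasDerivAt_exp s)).sub (hasDerivAt_pow (n + 2) s)
    · -- `k e^s / (k + e^s) = k - k * k / (k + e^s)` separates the leading term from an
      -- exponentially small one.
      refine IsLittleO.const_mul_right (by positivity) (((ih.const_mul_left k).sub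
        ((mul_profile_exp_isLittleO hk_pos hO).const_mul_left k)).congr_left fun s => ?_)
      have hne : k + Real.exp s ≠ 0 := by positivity
      have hk' : ((n + 2 : ℕ) : ℝ) = k := by push_cast [hk]; ring
      rw [hk']
      field_simp
      ring

/-! ### The profile as a function of the radius -/

/-- The parameter `τ = (n + 1) * (exp R - 1)` of `profile n`. It is the amount by which the inverse
of the least barycentric coordinate on the ball of radius `R`, which is `exp (-R) / (n + 1)`,
exceeds its value `n + 1` at the barycenter. -/
def excess (n : ℕ) (R : ℝ) : ℝ := (n + 1) * (Real.exp R - 1)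

lemma excess_pos (n : ℕ) {R : ℝ} (hR : 0 < R) : 0 < excess n R :=
  mul_pos (by positivity) (by linarith [Real.one_lt_exp_iff.2 hR])

lemma hasDerivAt_excess (n : ℕ) (R : ℝ) : HasDerivAt (excess n) ((n + 1) * Real.exp R) R :=
  ((Real.hasDerivAt_exp R).sub_const 1).const_mul _

/-- The radius in dimension `m` that corresponds to the radius `R` in dimension `m + 1` under the
recursive differential equation. -/
def shiftedRadius (m : ℕ) (R : ℝ) : ℝ :=
  R + Real.log (1 + 1 / (m + 1) - 1 / (m + 1) * Real.exp (-R))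

lemma shiftedRadius_pos (m : ℕ) {R : ℝ} (hR : 0 < R) : 0 < shiftedRadius m R := by
  have hE : Real.exp (-R) < 1 := Real.exp_lt_one_iff.2 (by linarith)
  have h : 0 < 1 / ((m : ℝ) + 1) := by positivity
  exact add_pos_of_pos_of_nonneg hR (Real.log_nonneg (by nlinarith))

lemma excess_shiftedRadius (m : ℕ) {R : ℝ} (hR : 0 < R) :
    excess m (shiftedRadius m R) = excess (m + 1) R := by
  have hE : Real.exp (-R) < 1 := Real.exp_lt_one_iff.2 (by linarith)
  have h : 0 < 1 / ((m : ℝ) + 1) := by positivity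
  have hexp : Real.exp R * Real.exp (-R) = 1 := by rw [← Real.exp_add]; simp
  rw [excess, excess, shiftedRadius, Real.exp_add, Real.exp_log (by nlinarith)]
  push_cast
  field_simp
  linear_combination -hexp

lemma hasDerivAt_profile_excess (m : ℕ) {R : ℝ} (hR : 0 < R) :
    HasDerivAt (fun R => profile (m + 1) (excess (m + 1) R))
      ((m + 1) / (1 - Real.exp (-R) / (m + 2)) * profile m (excess m (shiftedRadius m R))) R := by
  have h := (hasDerivAt_profile m (by linarith [excess_pos (m + 1) hR])).comp R
    (hasDerivAt_excess (m + 1) R)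
  rw [excess_shiftedRadius m hR]
  refine h.congr_deriv ?_
  have hE : Real.exp (-R) < 1 := Real.exp_lt_one_iff.2 (by linarith)
  have hexp : Real.exp R * Real.exp (-R) = 1 := by rw [← Real.exp_add]; simp
  have hsub : (m : ℝ) + 1 + excess (m + 1) R = (m + 2) * Real.exp R - 1 := by
    rw [excess]
    push_cast
    ring
  have hne : (m : ℝ) + 2 - Real.exp (-R) ≠ 0 := by linarith
  have hne' : (m + 2) * Real.exp R - 1 ≠ 0 := by
    rw [← hsub]
    have := excess_pos (m + 1) hR
    positivity
  rw [hsub, mul_right_comm]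
  congr 1
  push_cast
  field_simp
  linear_combination -((m : ℝ) + 2) * hexp

lemma exp_sub_one_isEquivalent : (fun R : ℝ => Real.exp R - 1) ~[𝓝 0] fun R => R := by
  refine IsLittleO.isEquivalent ((Real.exp_sub_sum_range_succ_isLittleO_pow 1).congr
    (fun R => ?_) fun R => pow_one R)
  simp [Finset.sum_range_succ, sub_sub]

lemma exp_sub_one_sub_isEquivalent :
    (fun R : ℝ => Real.exp R - 1 - R) ~[𝓝 0] fun R => R ^ 2 / 2 := by
  refine IsLittleO.isEquivalent (IsLittleO.congr_left (IsLittleO.trans_isBigO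
    (Real.exp_sub_sum_range_succ_isLittleO_pow 2) ?_) fun R => ?_)
  · exact (isBigO_refl _ _).const_mul_left 2 |>.congr_left fun R => by ring
  · simp [Finset.sum_range_succ, sub_sub]

lemma exp_sub_one_pow_sub_pow_isLittleO (n : ℕ) :
    (fun R : ℝ => (Real.exp R - 1) ^ n - R ^ n - n / 2 * R ^ (n + 1)) =o[𝓝 0]
      fun R => R ^ (n + 1) := by
  rcases n with _ | n
  · simp
  refine ((isLittleO_pow_sub_pow exp_sub_one_isEquivalent exp_sub_one_sub_isEquivalent
    (n + 1)).trans_isBigO ?_).congr_left fun R => ?_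
  · exact ((isBigO_refl _ _).const_mul_left (1 / 2)).congr_left fun R => by
      rw [Nat.add_sub_cancel]
      ring
  · rw [Nat.add_sub_cancel]
    ring

lemma profile_excess_isLittleO_nhdsGT_zero (n : ℕ) :
    (fun R : ℝ => n.factorial / ((n : ℝ) + 1) ^ n * profile n (excess n R)
      - (R ^ n - (n : ℝ) / 2 * R ^ (n + 1))) =o[𝓝[>] 0] fun R => R ^ (n + 1) := by
  have hτ : Tendsto (excess n) (𝓝[>] 0) (𝓝[>] 0) := by
    refine tendsto_nhdsWithin_iff.2 ⟨?_, eventually_mem_nhdsWithin.mono fun R => excess_pos n⟩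
    simpa [excess] using (hasDerivAt_excess n 0).continuousAt.tendsto.mono_left nhdsWithin_le_nhds
  have hpow := (exp_sub_one_isEquivalent.pow (n + 1)).mono (nhdsWithin_le_nhds (s := Set.Ioi 0))
  have hprofile := ((profile_isLittleO_nhdsGT_zero n).comp_tendsto hτ).trans_isBigO
    ((hpow.isBigO.const_mul_left (((n : ℝ) + 1) ^ (n + 1))).congr_left (f₂ := fun R =>
      excess n R ^ (n + 1)) fun R => by simp only [excess, Pi.pow_apply, mul_pow])
  have hexp := (exp_sub_one_pow_sub_pow_isLittleO n).mono (nhdsWithin_le_nhds (s := Set.Ioi 0))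
  refine (((hprofile.const_mul_left (n.factorial / ((n : ℝ) + 1) ^ n)).add hexp).sub
    (hpow.isLittleO.const_mul_left (n : ℝ))).congr_left fun R => ?_
  simp only [Function.comp_def, excess, mul_pow, Pi.pow_apply, Pi.sub_apply]
  field_simp
  ring

lemma log_excess_sub_tendsto (n : ℕ) :
    Tendsto (fun R => Real.log (excess n R) - R) atTop (𝓝 (Real.log (n + 1))) := by
  have h : Tendsto (fun R : ℝ => Real.log ((n + 1) * (1 - Real.exp (-R)))) atTop
      (𝓝 (Real.log ((n + 1) * (1 - 0)))) :=
    ((tendsto_const_nhds.sub Real.tendsto_exp_neg_atTop_nhds_zero).const_mul _).log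
      (by positivity)
  rw [sub_zero, mul_one] at h
  refine h.congr' ((eventually_gt_atTop 0).mono fun R hR => ?_)
  have hfactor : (n + 1) * (1 - Real.exp (-R)) = excess n R / Real.exp R := by
    rw [excess, Real.exp_neg]
    field_simp
  rw [hfactor, Real.log_div (excess_pos n hR).ne' (Real.exp_pos R).ne', Real.log_exp]

lemma profile_excess_isLittleO_atTop {n : ℕ} (hn : 1 ≤ n) :
    (fun R : ℝ => profile n (excess n R) - R ^ n - n * R ^ (n - 1) * Real.log (n + 1)) =o[atTop]
      fun R => R ^ (n - 1) := by
  obtain ⟨m, rfl⟩ : ∃ m, n = m + 1 := ⟨n - 1, by omega⟩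
  set σ : ℝ → ℝ := fun R => Real.log (excess (m + 1) R) with hσ
  have hlog : Real.log (((m + 1 : ℕ) : ℝ) + 1) ≠ 0 :=
    (Real.log_pos (by push_cast; linarith [m.cast_nonneg (α := ℝ)])).ne'
  have hdiff : Tendsto (σ - fun R => R) atTop (𝓝 (Real.log (((m + 1 : ℕ) : ℝ) + 1))) :=
    log_excess_sub_tendsto (m + 1)
  have hequiv : σ ~[atTop] fun R => R :=
    (hdiff.isBigO_one ℝ).trans_isLittleO (isLittleO_const_id_atTop 1)
  have hprofile := ((profile_exp_sub_pow_isLittleO m).comp_tendsto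
    (hequiv.symm.tendsto_atTop tendsto_id)).trans_isBigO (hequiv.pow m).isBigO
  have hpow := (isLittleO_pow_sub_pow hequiv ((isEquivalent_const_iff_tendsto hlog).2 hdiff)
    (m + 1)).trans_isBigO ((isBigO_refl (fun R : ℝ => R ^ m) atTop).const_mul_left
      (Real.log (((m + 1 : ℕ) : ℝ) + 1)) |>.congr_left fun R => by simp [mul_comm])
  refine (hprofile.add hpow).congr' ((eventually_gt_atTop 0).mono fun R hR => ?_) .rfl
  simp only [Function.comp_apply, Function.const_apply, hσ, Nat.add_sub_cancel,
    Real.exp_log (excess_pos (m + 1) hR)]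
  ring

/-! ### Iterated convolutions -/

section IterConv

variable {G : Type*} [AddCommGroup G] [MeasureSpace G]

/-- The convolution `w ⋆ ⋯ ⋆ w ⋆ f` with `n` factors `w`, with respect to the volume of `G`. -/
def iterConv (w f : G → ENNReal) : ℕ → G → ENNReal
  | 0 => f
  | n + 1 => w ⋆ₗ iterConv w f n

variable {w f g : G → ENNReal} [MeasurableAdd₂ G] [MeasurableNeg G]
  [SigmaFinite (volume : Measure G)]

@[fun_prop]
lemma measurable_iterConv (hw : Measurable w) (hf : Measurable f) (n : ℕ) :
    Measurable (iterConv w f n) := by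
  induction n with
  | zero => exact hf
  | succ n ih => exact measurable_lconvolution _ hw ih

lemma lintegral_prod_mul_comp_sub_sum (hw : Measurable w) (hf : Measurable f) (n : ℕ) (t : G) :
    ∫⁻ x : Fin n → G, (∏ i, w (x i)) * f (t - ∑ i, x i) = iterConv w f n t := by
  induction n generalizing t with
  | zero => simp [iterConv, volume_pi]
  | succ n ih =>
    rw [← (volume_preserving_piFinSuccAbove (fun _ : Fin (n + 1) => G) 0).symm.lintegral_comp
      (by fun_prop), Measure.volume_eq_prod, lintegral_prod _ (by fun_prop)]
    refine lintegral_congr fun y => ?_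
    rw [neg_add_eq_sub, ← ih (t - y), ← lintegral_const_mul _ (by fun_prop)]
    simp [Fin.prod_univ_succ, Fin.sum_univ_succ, mul_assoc, sub_sub]

variable [(volume : Measure G).IsAddLeftInvariant] [(volume : Measure G).IsNegInvariant]

lemma lconvolution_left_comm (hf : Measurable f) (hg : Measurable g) (hw : Measurable w) :
    f ⋆ₗ g ⋆ₗ w = g ⋆ₗ f ⋆ₗ w := by
  rw [lconvolution_assoc hf hg hw, lconvolution_comm (f := f), ← lconvolution_assoc hg hf hw]

lemma lconvolution_iterConv_comm (hw : Measurable w) (hf : Measurable f) (hg : Measurable g)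
    (n : ℕ) : f ⋆ₗ iterConv w g n = g ⋆ₗ iterConv w f n := by
  induction n with
  | zero => exact lconvolution_comm
  | succ n ih =>
    rw [iterConv, iterConv, lconvolution_left_comm hf hw (measurable_iterConv hw hg n), ih,
      lconvolution_left_comm hw hg (measurable_iterConv hw hf n)]

end IterConv

lemma lconvolution_eq_zero_of_lt {f g : ℝ → ENNReal} {a b : ℝ} (hf : ∀ t < a, f t = 0)
    (hg : ∀ t < b, g t = 0) {t : ℝ} (ht : t < a + b) : (f ⋆ₗ g) t = 0 := by
  refine lintegral_eq_zero_of_ae_eq_zero (.of_forall fun y => ?_)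
  rcases lt_or_ge y a with hy | hy
  · simp [hf y hy]
  · simp [hg (-y + t) (by linarith)]

lemma iterConv_eq_zero_of_lt {w f : ℝ → ENNReal} {a b : ℝ} (hw : ∀ t < a, w t = 0)
    (hf : ∀ t < b, f t = 0) (n : ℕ) {t : ℝ} (ht : t < n * a + b) : iterConv w f n t = 0 := by
  induction n generalizing t with
  | zero => exact hf t (by simpa using ht)
  | succ n ih =>
    exact lconvolution_eq_zero_of_lt hw (fun s => ih) (by push_cast at ht; linarith)

lemma ofReal_mul_lconvolution {f g : ℝ → ENNReal} (hf : Measurable f) (hg : Measurable g)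
    (hf0 : ∀ t < 0, f t = 0) (hg0 : ∀ t < 0, g t = 0) (t : ℝ) :
    ENNReal.ofReal t * (f ⋆ₗ g) t = ((fun s => ENNReal.ofReal s * f s) ⋆ₗ g) t +
      (f ⋆ₗ fun s => ENNReal.ofReal s * g s) t := by
  simp only [lconvolution_def]
  rw [← lintegral_const_mul _ (by fun_prop), ← lintegral_add_left (by fun_prop)]
  refine lintegral_congr fun y => ?_
  rcases lt_or_ge y 0 with hy | hy
  · simp [hf0 y hy]
  rcases lt_or_ge (-y + t) 0 with hyt | hyt
  · simp [hg0 _ hyt]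
  rw [← add_neg_cancel_left y t, ENNReal.ofReal_add hy hyt, add_neg_cancel_left]
  ring

lemma ofReal_mul_iterConv_self {w : ℝ → ENNReal} (hw : Measurable w) (hw0 : ∀ t < 0, w t = 0)
    (n : ℕ) (t : ℝ) : ENNReal.ofReal t * iterConv w w n t =
      (n + 1) * iterConv w (fun s => ENNReal.ofReal s * w s) n t := by
  induction n generalizing t with
  | zero => simp [iterConv]
  | succ n ih =>
    have hmul : (w ⋆ₗ fun s => ENNReal.ofReal s * iterConv w w n s) t =
        (n + 1) * iterConv w (fun s => ENNReal.ofReal s * w s) (n + 1) t := by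
      simp only [ih, iterConv, lconvolution_def]
      rw [← lintegral_const_mul _ (by fun_prop)]
      exact lintegral_congr fun y => by ring
    rw [iterConv, ofReal_mul_lconvolution hw (by fun_prop) hw0
      (fun s hs => iterConv_eq_zero_of_lt hw0 hw0 n (by simpa using hs)), hmul,
      lconvolution_iterConv_comm hw (by fun_prop) hw, ← iterConv]
    push_cast
    ring

/-! ### Iterated integrals over truncated simplices -/

/-- The indicator function of `[c, ∞)`. -/
def step (c : ℝ) : ℝ → ENNReal := (Set.Ici c).indicator 1

/-- The function `t ↦ 1 / t` truncated to `[c, ∞)`. -/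
def truncInv (c : ℝ) : ℝ → ENNReal := (Set.Ici c).indicator fun t => ENNReal.ofReal t⁻¹

@[fun_prop]
lemma measurable_step (c : ℝ) : Measurable (step c) :=
  measurable_one.indicator measurableSet_Ici

@[fun_prop]
lemma measurable_truncInv (c : ℝ) : Measurable (truncInv c) :=
  Measurable.indicator (by fun_prop) measurableSet_Ici

lemma step_of_lt {c t : ℝ} (h : t < c) : step c t = 0 :=
  Set.indicator_of_notMem (Set.notMem_Ici.2 h) _

lemma truncInv_of_lt {c t : ℝ} (h : t < c) : truncInv c t = 0 :=
  Set.indicator_of_notMem (Set.notMem_Ici.2 h) _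

lemma ofReal_mul_truncInv {c : ℝ} (hc : 0 < c) (t : ℝ) :
    ENNReal.ofReal t * truncInv c t = step c t := by
  rcases lt_or_ge t c with h | h
  · simp [step_of_lt h, truncInv_of_lt h]
  · have ht : 0 < t := hc.trans_le h
    rw [truncInv, step, Set.indicator_of_mem (Set.mem_Ici.2 h),
      Set.indicator_of_mem (Set.mem_Ici.2 h), ENNReal.ofReal_inv_of_pos ht, Pi.one_apply,
      ENNReal.mul_inv_cancel (ENNReal.ofReal_pos.2 ht).ne' ENNReal.ofReal_ne_top]

lemma step_lconvolution (c : ℝ) (f : ℝ → ENNReal) (t : ℝ) :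
    (step c ⋆ₗ f) t = ∫⁻ s in Set.Iic (t - c), f s := by
  rw [lconvolution_comm, lconvolution_def, ← lintegral_indicator measurableSet_Iic]
  refine lintegral_congr fun s => ?_
  have : c ≤ -s + t ↔ s ≤ t - c := by constructor <;> intro h <;> linarith
  simp [step, Set.indicator_apply, this]

lemma setLIntegral_Iic_eq_ofReal_integral {F : ℝ → ENNReal} {f : ℝ → ℝ} {a b : ℝ} (hab : a ≤ b)
    (hF : ∀ t < a, F t = 0) (hFf : ∀ t ∈ Set.Icc a b, F t = ENNReal.ofReal (f t))
    (hf : ContinuousOn f (Set.Icc a b)) (hf0 : ∀ t ∈ Set.Icc a b, 0 ≤ f t) :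
    ∫⁻ t in Set.Iic b, F t = ENNReal.ofReal (∫ t in a..b, f t) := by
  rw [intervalIntegral.integral_of_le hab, ← integral_Icc_eq_integral_Ioc,
    ofReal_integral_eq_lintegral_ofReal hf.integrableOn_Icc
      ((ae_restrict_iff' measurableSet_Icc).2 (.of_forall hf0)),
    ← setLIntegral_congr_fun measurableSet_Icc hFf, ← lintegral_indicator measurableSet_Iic,
    ← lintegral_indicator measurableSet_Icc]
  refine lintegral_congr fun t => ?_
  rcases lt_or_ge t a with h | h
  · simp [Set.indicator_apply, hF t h]
  · simp [Set.indicator_apply, h]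

lemma iterConv_truncInv_self {c : ℝ} (hc : 0 < c) (n : ℕ) (t : ℝ) :
    iterConv (truncInv c) (truncInv c) n t =
      (n + 1) * (ENNReal.ofReal t⁻¹ * iterConv (truncInv c) (step c) n t) := by
  rcases le_or_gt t 0 with h | h
  · rw [iterConv_eq_zero_of_lt (fun s => truncInv_of_lt) (fun s => truncInv_of_lt) n
      (h.trans_lt (by positivity)), ENNReal.ofReal_of_nonpos (inv_nonpos.2 h), zero_mul, mul_zero]
  · have hderiv := ofReal_mul_iterConv_self (measurable_truncInv c)
      (fun s hs => truncInv_of_lt (hs.trans hc)) n t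
    simp only [ofReal_mul_truncInv hc] at hderiv
    rw [mul_left_comm, ← hderiv, ← mul_assoc, ← ENNReal.ofReal_mul (inv_nonneg.2 h.le),
      inv_mul_cancel₀ h.ne', ENNReal.ofReal_one, one_mul]

lemma iterConv_truncInv_step_succ {c : ℝ} (hc : 0 < c) (n : ℕ) (S : ℝ) :
    iterConv (truncInv c) (step c) (n + 1) S = ∫⁻ t in Set.Iic (S - c),
      (n + 1) * (ENNReal.ofReal t⁻¹ * iterConv (truncInv c) (step c) n t) := by
  rw [iterConv, lconvolution_iterConv_comm (measurable_truncInv c) (measurable_truncInv c)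
    (measurable_step c), step_lconvolution]
  simp only [iterConv_truncInv_self hc]

lemma integral_inv_mul_profile {c : ℝ} (hc : 0 < c) (n : ℕ) (S : ℝ) :
    ∫ t in (n + 1) * c..S - c, (n + 1) * (t⁻¹ * profile n (t / c - (n + 1))) =
      profile (n + 1) (S / c - ((n + 1 : ℕ) + 1)) := by
  have h := intervalIntegral.smul_integral_comp_add_mul (a := 0) (b := S / c - ((n + 1 : ℕ) + 1))
    (fun t => (n + 1) * (t⁻¹ * profile n (t / c - (n + 1)))) c ((n + 1) * c)
  have hupper : (n + 1) * c + c * (S / c - ((n + 1 : ℕ) + 1)) = S - c := by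
    push_cast
    field_simp
    ring
  rw [mul_zero, add_zero, hupper] at h
  rw [← h, profile, smul_eq_mul, ← intervalIntegral.integral_const_mul]
  refine intervalIntegral.integral_congr fun t _ => ?_
  have harg : ((n + 1) * c + c * t) / c - (n + 1) = t := by
    field_simp
    ring
  have hfactor : (n + 1) * c + c * t = c * (n + 1 + t) := by ring
  simp only [harg]
  rw [hfactor, mul_inv]
  field_simp

lemma iterConv_truncInv_step {c : ℝ} (hc : 0 < c) (n : ℕ) {S : ℝ} (hS : (n + 1) * c ≤ S) :
    iterConv (truncInv c) (step c) n S = ENNReal.ofReal (profile n (S / c - (n + 1))) := by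
  induction n generalizing S with
  | zero =>
    have hS' : c ≤ S := by simpa using hS
    simp [iterConv, profile, step, hS']
  | succ n ih =>
    have hle : (n + 1) * c ≤ S - c := by push_cast at hS; linarith
    have hmem {t : ℝ} (ht : (n + 1) * c ≤ t) : 0 < t ∧ 0 ≤ t / c - (n + 1) :=
      ⟨lt_of_lt_of_le (by positivity) ht, by rwa [sub_nonneg, le_div_iff₀ hc]⟩
    have hcont : ContinuousOn (fun t : ℝ => (n + 1) * (t⁻¹ * profile n (t / c - (n + 1))))
        (Set.Icc ((n + 1) * c) (S - c)) := by
      refine continuousOn_const.mul ((continuousOn_id.inv₀ fun t ht => (hmem ht.1).1.ne').mul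
        ((continuousOn_profile n).comp (by fun_prop) fun t ht => ?_))
      exact Set.mem_Ioi.2 (by linarith [(hmem ht.1).2])
    rw [iterConv_truncInv_step_succ hc, setLIntegral_Iic_eq_ofReal_integral hle (fun t ht => ?_)
      (fun t ht => ?_) hcont fun t ht => ?_]
    · rw [integral_inv_mul_profile hc]
    · rw [iterConv_eq_zero_of_lt (fun s => truncInv_of_lt) (fun s => step_of_lt) n (by linarith)]
      simp
    · have := profile_nonneg n (hmem ht.1).2
      have := (hmem ht.1).1
      rw [ih ht.1, ENNReal.ofReal_mul (p := (n : ℝ) + 1) (by positivity),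
        ENNReal.ofReal_mul (p := t⁻¹) (by positivity),
        ENNReal.ofReal_add (by positivity) zero_le_one, ENNReal.ofReal_natCast, ENNReal.ofReal_one]
    · have := profile_nonneg n (hmem ht.1).2
      have := (hmem ht.1).1
      positivity

lemma iterConv_step_zero (n : ℕ) {t : ℝ} (ht : 0 ≤ t) :
    iterConv (step 0) (step 0) n t = ENNReal.ofReal (t ^ n / n.factorial) := by
  induction n generalizing t with
  | zero => simp [iterConv, step, ht]
  | succ n ih =>
    rw [iterConv, step_lconvolution, sub_zero, setLIntegral_Iic_eq_ofReal_integral ht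
      (fun s hs => iterConv_eq_zero_of_lt (fun s => step_of_lt) (fun s => step_of_lt) n
        (by simpa using hs)) (fun s hs => ih hs.1) (by fun_prop)
      fun s hs => div_nonneg (pow_nonneg hs.1 n) (by positivity)]
    rw [intervalIntegral.integral_div, integral_pow, Nat.factorial_succ]
    push_cast
    congr 1
    field_simp
    simp

/-! ### Integrals over truncated simplices -/

/-- The points of `ℝⁿ` all of whose barycentric coordinates `x₁, …, xₙ, 1 - ∑ xᵢ` are at least
`c`. For `c = 0` this is the closed standard simplex, and small positive `c` give the Funk balls
around its barycenter. -/
def truncatedSimplex (n : ℕ) (c : ℝ) : Set (E n) :=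
  {x | (∀ i, c ≤ x i) ∧ c ≤ 1 - ∑ i, x i}

lemma isClosed_truncatedSimplex (n : ℕ) (c : ℝ) : IsClosed (truncatedSimplex n c) := by
  simp only [truncatedSimplex, Set.ofPred_and, Set.ofPred_forall]
  exact (isClosed_iInter fun i => isClosed_le (by fun_prop) (by fun_prop)).inter
    (isClosed_le (by fun_prop) (by fun_prop))

lemma measurableSet_truncatedSimplex (n : ℕ) (c : ℝ) : MeasurableSet (truncatedSimplex n c) :=
  (isClosed_truncatedSimplex n c).measurableSet

lemma truncatedSimplex_subset_stdSimplex (n : ℕ) {c : ℝ} (hc : 0 < c) :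
    truncatedSimplex n c ⊆ stdSimplex n :=
  fun _ hx => ⟨fun i => hc.trans_le (hx.1 i), by linarith [hx.2]⟩

lemma setLIntegral_truncatedSimplex {u f : ℝ → ENNReal} (hu : Measurable u) (hf : Measurable f)
    (n : ℕ) (c : ℝ) :
    ∫⁻ x in truncatedSimplex n c, (∏ i, u (x i)) * f (1 - ∑ i, x i) =
      iterConv ((Set.Ici c).indicator u) ((Set.Ici c).indicator f) n 1 := by
  have hu' : Measurable ((Set.Ici c).indicator u) := hu.indicator measurableSet_Ici
  have hf' : Measurable ((Set.Ici c).indicator f) := hf.indicator measurableSet_Ici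
  rw [← lintegral_prod_mul_comp_sub_sum hu' hf',
    ← (PiLp.volume_preserving_ofLp (Fin n)).lintegral_comp (by fun_prop),
    ← lintegral_indicator (measurableSet_truncatedSimplex n c)]
  refine lintegral_congr fun x => ?_
  by_cases hx : x ∈ truncatedSimplex n c
  · simp [Set.indicator_of_mem hx, hx.1, hx.2]
  · rw [Set.indicator_of_notMem hx, eq_comm, mul_eq_zero, Finset.prod_eq_zero_iff]
    by_contra! hne
    refine hx ⟨fun i => ?_, ?_⟩
    · exact Set.mem_of_indicator_ne_zero (hne.1 i (Finset.mem_univ i))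
    · exact Set.mem_of_indicator_ne_zero hne.2

lemma volume_truncatedSimplex_zero (n : ℕ) :
    volume (truncatedSimplex n 0) = ENNReal.ofReal (1 / n.factorial) := by
  have h := setLIntegral_truncatedSimplex measurable_one measurable_one n 0
  rw [← step, iterConv_step_zero n zero_le_one] at h
  simpa using h

lemma ofReal_one_div_prod {ι : Type*} {s : Finset ι} {x : ι → ℝ} (hx : ∀ i ∈ s, 0 ≤ x i) :
    ENNReal.ofReal (1 / ∏ i ∈ s, x i) = ∏ i ∈ s, ENNReal.ofReal (x i)⁻¹ := by
  rw [one_div, ← Finset.prod_inv_distrib,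
    ENNReal.ofReal_prod_of_nonneg fun i hi => inv_nonneg.2 (hx i hi)]

section InvProd

variable {c : ℝ} (hc : 0 < c) (n : ℕ)

include hc

lemma setLIntegral_one_div_prod :
    ∫⁻ x in truncatedSimplex n c, ENNReal.ofReal (1 / ∏ i, x i) =
      iterConv (truncInv c) (step c) n 1 := by
  rw [truncInv, step, ← setLIntegral_truncatedSimplex (by fun_prop) measurable_one]
  refine setLIntegral_congr_fun (measurableSet_truncatedSimplex n c) fun x hx => ?_
  simp only [ofReal_one_div_prod fun i _ => hc.le.trans (hx.1 i), Pi.one_apply, mul_one]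

lemma setLIntegral_one_div_prod_barycentric :
    ∫⁻ x in truncatedSimplex n c, ENNReal.ofReal (1 / ((1 - ∑ i, x i) * ∏ i, x i)) =
      (n + 1) * ∫⁻ x in truncatedSimplex n c, ENNReal.ofReal (1 / ∏ i, x i) := by
  have hself := iterConv_truncInv_self hc n 1
  rw [inv_one, ENNReal.ofReal_one, one_mul] at hself
  rw [setLIntegral_one_div_prod hc, ← hself, truncInv,
    ← setLIntegral_truncatedSimplex (by fun_prop) (by fun_prop)]
  refine setLIntegral_congr_fun (measurableSet_truncatedSimplex n c) fun x hx => ?_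
  simp only [← ofReal_one_div_prod fun i _ => hc.le.trans (hx.1 i)]
  rw [← ENNReal.ofReal_mul' (inv_nonneg.2 (hc.le.trans hx.2)), one_div, one_div, mul_inv, mul_comm]

end InvProd

/-! ### Funk balls are homothets -/

/-- The (non-symmetric) norm at `p` of the Funk geometry of `K`: the Minkowski functional of
`K - p`. -/
def funkNorm {n : ℕ} (K : Set (E n)) (p : E n) : E n → ℝ :=
  gauge ((fun u => p + u) ⁻¹' K)

lemma funkNorm_smul_of_nonneg {n : ℕ} (K : Set (E n)) (p : E n) {a : ℝ} (ha : 0 ≤ a) (v : E n) :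
    funkNorm K p (a • v) = a * funkNorm K p v :=
  gauge_smul_of_nonneg ha v

section FunkBall

variable {n : ℕ} {K : Set (E n)} {p : E n} (hc : Convex ℝ K) (ho : IsOpen K) (hp : p ∈ K)

include ho hp

lemma preimage_add_left_mem_nhds_zero : (fun u => p + u) ⁻¹' K ∈ 𝓝 0 :=
  (ho.preimage (continuous_const_add p)).mem_nhds (by simpa using hp)

lemma funkNorm_pos (hb : Bornology.IsBounded K) {v : E n} (hv : v ≠ 0) : 0 < funkNorm K p v := by
  have hbdd : Bornology.IsBounded ((fun u => p + u) ⁻¹' K) :=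
    (IsometryEquiv.addLeft p).isometry.antilipschitz.isBounded_preimage hb
  exact (gauge_pos (absorbent_nhds_zero (preimage_add_left_mem_nhds_zero ho hp))
    ((NormedSpace.isVonNBounded_iff ℝ).2 hbdd)).2 hv

include hc

lemma funkNorm_eq_one_iff (v : E n) : funkNorm K p v = 1 ↔ p + v ∈ frontier K := by
  rw [funkNorm, gauge_eq_one_iff_mem_frontier (hc.translate_preimage_right p)
    (preimage_add_left_mem_nhds_zero ho hp)]
  exact Set.ext_iff.1 ((Homeomorph.addLeft p).preimage_frontier K).symm v

lemma funkNorm_le_one_iff (v : E n) : funkNorm K p v ≤ 1 ↔ p + v ∈ closure K := by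
  rw [funkNorm, gauge_le_one_iff_mem_closure (hc.translate_preimage_right p)
    (preimage_add_left_mem_nhds_zero ho hp)]
  exact Set.ext_iff.1 ((Homeomorph.addLeft p).preimage_closure K).symm v

lemma funkNorm_lt_one_iff (v : E n) : funkNorm K p v < 1 ↔ p + v ∈ K := by
  rw [funkNorm, gauge_lt_one_iff_mem_interior (hc.translate_preimage_right p)
    (preimage_add_left_mem_nhds_zero ho hp), (ho.preimage (continuous_const_add p)).interior_eq]
  rfl

lemma exitTime_eq_inv_funkNorm (hb : Bornology.IsBounded K) {v : E n} (hv : v ≠ 0) :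
    exitTime K p v = (funkNorm K p v)⁻¹ := by
  have hpos := funkNorm_pos ho hp hb hv
  have hset : {t : ℝ | 0 < t ∧ p + t • v ∈ frontier K} = {(funkNorm K p v)⁻¹} := by
    ext t
    rw [Set.mem_ofPred_eq, Set.mem_singleton_iff, ← funkNorm_eq_one_iff hc ho hp]
    constructor
    · rintro ⟨ht, h⟩
      rw [funkNorm_smul_of_nonneg K p ht.le] at h
      exact eq_inv_of_mul_eq_one_left h
    · rintro rfl
      rw [funkNorm_smul_of_nonneg K p (inv_pos.2 hpos).le]
      exact ⟨inv_pos.2 hpos, inv_mul_cancel₀ hpos.ne'⟩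
  rw [exitTime, hset, csInf_singleton]

lemma funkDist_eq_neg_log (hb : Bornology.IsBounded K) {z : E n} (hz : z ∈ K) :
    funkDist K p z = -Real.log (1 - funkNorm K p (z - p)) := by
  by_cases hpz : p = z
  · simp [funkDist, hpz, funkNorm]
  have hv : z - p ≠ 0 := sub_ne_zero.2 (Ne.symm hpz)
  set g := funkNorm K p (z - p)
  have hg0 : 0 < g := funkNorm_pos ho hp hb hv
  have hg1 : g < 1 := (funkNorm_lt_one_iff hc ho hp _).2 (by simpa using hz)
  have hnorm : ‖z - p‖ ≠ 0 := norm_ne_zero_iff.2 hv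
  have hpb : dist p (exitPoint K p z) = g⁻¹ * ‖z - p‖ := by
    rw [exitPoint, exitTime_eq_inv_funkNorm hc ho hp hb hv, dist_self_add_right, norm_smul,
      Real.norm_of_nonneg (inv_pos.2 hg0).le]
  have hzb : dist z (exitPoint K p z) = (g⁻¹ - 1) * ‖z - p‖ := by
    have hsub : p + g⁻¹ • (z - p) - z = (g⁻¹ - 1) • (z - p) := by module
    rw [exitPoint, exitTime_eq_inv_funkNorm hc ho hp hb hv, dist_comm, dist_eq_norm, hsub,
      norm_smul, Real.norm_of_nonneg (sub_nonneg.2 (one_lt_inv_iff₀.2 ⟨hg0, hg1⟩).le)]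
  have hratio : g⁻¹ / (g⁻¹ - 1) = (1 - g)⁻¹ := by
    field_simp
  rw [funkDist, if_neg hpz, hpb, hzb, mul_div_mul_right _ _ hnorm, hratio, Real.log_inv]

lemma funkBall_eq_image_homothety (hb : Bornology.IsBounded K) {R : ℝ} (hR : 0 < R) :
    funkBall K p R = AffineMap.homothety p (1 - Real.exp (-R)) '' closure K := by
  have hexp : Real.exp (-R) < 1 := Real.exp_lt_one_iff.2 (neg_neg_of_pos hR)
  have hscale : 0 < 1 - Real.exp (-R) := sub_pos.2 hexp
  have hdist (z : E n) (hz : z ∈ K) :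
      funkDist K p z ≤ R ↔ funkNorm K p (z - p) ≤ 1 - Real.exp (-R) := by
    have hlt := (funkNorm_lt_one_iff hc ho hp (z - p)).2 (by simpa using hz)
    rw [funkDist_eq_neg_log hc ho hp hb hz, neg_le, Real.le_log_iff_exp_le (sub_pos.2 hlt),
      le_sub_comm]
  have hclosure (v : E n) : funkNorm K p ((1 - Real.exp (-R)) • v) ≤ 1 - Real.exp (-R) ↔
      p + v ∈ closure K := by
    rw [← funkNorm_le_one_iff hc ho hp, funkNorm_smul_of_nonneg K p hscale.le,
      mul_le_iff_le_one_right hscale]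
  ext z
  constructor
  · rintro ⟨hz, hzR⟩
    have hz' : (1 - Real.exp (-R)) • (1 - Real.exp (-R))⁻¹ • (z - p) = z - p :=
      smul_inv_smul₀ hscale.ne' _
    refine ⟨p + (1 - Real.exp (-R))⁻¹ • (z - p), ?_, by simp [AffineMap.homothety_apply, hz']⟩
    rwa [← hclosure, hz', ← hdist z hz]
  · rintro ⟨y, hy, rfl⟩
    have hle : funkNorm K p ((1 - Real.exp (-R)) • (y - p)) ≤ 1 - Real.exp (-R) :=
      (hclosure _).2 (by simpa using hy)
    have hmem : AffineMap.homothety p (1 - Real.exp (-R)) y ∈ K := by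
      have := (funkNorm_lt_one_iff hc ho hp _).1 (hle.trans_lt (by linarith [Real.exp_pos (-R)]))
      rwa [AffineMap.homothety_apply, vsub_eq_sub, vadd_eq_add, add_comm]
    exact ⟨hmem, (hdist _ hmem).2 (by simpa [AffineMap.homothety_apply] using hle)⟩

end FunkBall

/-! ### The Funk geometry of the standard simplex -/

lemma convex_stdSimplex (n : ℕ) : Convex ℝ (stdSimplex n) := by
  simp only [stdSimplex, Set.ofPred_and, Set.ofPred_forall]
  refine (convex_iInter fun i => ?_).inter ?_
  · exact convex_halfSpace_gt (EuclideanSpace.proj i : E n →L[ℝ] ℝ).toLinearMap.isLinear 0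
  · exact convex_halfSpace_lt ⟨fun x y => by simp [Finset.sum_add_distrib],
      fun a x => by simp [Finset.mul_sum]⟩ 1

lemma isOpen_stdSimplex (n : ℕ) : IsOpen (stdSimplex n) := by
  simp only [stdSimplex, Set.ofPred_and, Set.ofPred_forall]
  exact (isOpen_iInter_of_finite fun i => isOpen_lt (by fun_prop) (by fun_prop)).inter
    (isOpen_lt (by fun_prop) (by fun_prop))

lemma isBounded_stdSimplex (n : ℕ) : Bornology.IsBounded (stdSimplex n) := by
  refine ((PiLp.antilipschitzWith_ofLp 2 _).isBounded_preimage
    (Metric.isBounded_Icc (0 : Fin n → ℝ) 1)).subset fun x hx => ⟨fun i => (hx.1 i).le, fun i => ?_⟩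
  exact (Finset.single_le_sum (fun j _ => (hx.1 j).le) (Finset.mem_univ i)).trans hx.2.le

lemma sum_stdBarycenter (n : ℕ) : ∑ i, stdBarycenter n i = 1 - 1 / ((n : ℝ) + 1) := by
  simp only [stdBarycenter, Finset.sum_const, Finset.card_univ, Fintype.card_fin, nsmul_eq_mul]
  field_simp
  ring

lemma stdBarycenter_mem (n : ℕ) : stdBarycenter n ∈ stdSimplex n := by
  have hpos : 0 < 1 / ((n : ℝ) + 1) := by positivity
  exact ⟨fun _ => hpos, by linarith [sum_stdBarycenter n]⟩

lemma image_homothety_truncatedSimplex (n : ℕ) {a : ℝ} (ha : 0 < a) (c : ℝ) :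
    AffineMap.homothety (stdBarycenter n) a '' truncatedSimplex n c =
      truncatedSimplex n ((1 - a) / (n + 1) + a * c) := by
  have hcoord (y : E n) (i : Fin n) :
      AffineMap.homothety (stdBarycenter n) a y i = (1 - a) / (n + 1) + a * y i := by
    simp only [AffineMap.homothety_apply, stdBarycenter, vsub_eq_sub, vadd_eq_add, PiLp.add_apply,
      PiLp.smul_apply, PiLp.sub_apply, smul_eq_mul]
    ring
  have hlast (y : E n) : 1 - ∑ i, AffineMap.homothety (stdBarycenter n) a y i =
      (1 - a) / (n + 1) + a * (1 - ∑ i, y i) := by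
    simp only [hcoord, Finset.sum_add_distrib, ← Finset.mul_sum, Finset.sum_const,
      Finset.card_univ, Fintype.card_fin, nsmul_eq_mul]
    field_simp
    ring
  have hmem (y : E n) : AffineMap.homothety (stdBarycenter n) a y ∈
      truncatedSimplex n ((1 - a) / (n + 1) + a * c) ↔ y ∈ truncatedSimplex n c := by
    simp only [truncatedSimplex, Set.mem_ofPred_eq, hlast]
    simp only [hcoord, add_le_add_iff_left, mul_le_mul_iff_right₀ ha]
  ext x
  constructor
  · rintro ⟨y, hy, rfl⟩
    exact (hmem y).2 hy
  · intro hx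
    have hinv : AffineMap.homothety (stdBarycenter n) a
        (AffineMap.homothety (stdBarycenter n) a⁻¹ x) = x := by
      rw [← AffineMap.homothety_mul_apply, mul_inv_cancel₀ ha.ne', AffineMap.homothety_one,
        AffineMap.id_apply]
    exact ⟨_, (hmem _).1 (by rwa [hinv]), hinv⟩

lemma closure_stdSimplex (n : ℕ) : closure (stdSimplex n) = truncatedSimplex n 0 := by
  have hsub : stdSimplex n ⊆ truncatedSimplex n 0 :=
    fun x hx => ⟨fun i => (hx.1 i).le, sub_nonneg.2 hx.2.le⟩
  refine (closure_minimal hsub (isClosed_truncatedSimplex n 0)).antisymm fun x hx => ?_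
  have hlim : Tendsto (fun a : ℝ => AffineMap.homothety (stdBarycenter n) a x) (𝓝[<] 1) (𝓝 x) := by
    have hcont : Continuous fun a : ℝ => AffineMap.homothety (stdBarycenter n) a x := by
      simp only [AffineMap.homothety_apply]
      fun_prop
    simpa using (hcont.tendsto 1).mono_left nhdsWithin_le_nhds
  refine mem_closure_of_tendsto hlim ?_
  filter_upwards [self_mem_nhdsWithin, nhdsWithin_le_nhds (lt_mem_nhds one_pos)] with a ha1 ha0
  have hpos : 0 < (1 - a) / ((n : ℝ) + 1) + a * 0 := by
    have := sub_pos.2 (Set.mem_Iio.1 ha1)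
    positivity
  exact truncatedSimplex_subset_stdSimplex n hpos
    (image_homothety_truncatedSimplex n ha0 0 ▸ Set.mem_image_of_mem _ hx)

lemma simplexBall_eq_truncatedSimplex (n : ℕ) {R : ℝ} (hR : 0 < R) :
    simplexBall n R = truncatedSimplex n (Real.exp (-R) / (n + 1)) := by
  rw [simplexBall, funkBall_eq_image_homothety (convex_stdSimplex n) (isOpen_stdSimplex n)
    (stdBarycenter_mem n) (isBounded_stdSimplex n) hR, closure_stdSimplex,
    image_homothety_truncatedSimplex n (sub_pos.2 (Real.exp_lt_one_iff.2 (neg_neg_of_pos hR))),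
    sub_sub_cancel, mul_zero, add_zero]

lemma polarAt_stdSimplex {n : ℕ} (p : E n) :
    polarAt (stdSimplex n) p = {ξ | (∀ j, ξ j - inner ℝ ξ p ≤ 1) ∧ -inner ℝ ξ p ≤ 1} := by
  have hinner (ξ x : E n) : inner ℝ ξ x = ∑ i, x i * ξ i := by simp [PiLp.inner_apply]
  ext ξ
  constructor
  · intro h
    have hcl : truncatedSimplex n 0 ⊆ {x | inner ℝ ξ (x - p) ≤ 1} :=
      closure_stdSimplex n ▸ closure_minimal h (isClosed_le (by fun_prop) continuous_const)
    constructor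
    · intro j
      have hvertex : EuclideanSpace.single j (1 : ℝ) ∈ truncatedSimplex n 0 :=
        ⟨fun i => by simp only [PiLp.single_apply]; split_ifs <;> norm_num,
          by simp [PiLp.single_apply]⟩
      simpa [inner_sub_right, EuclideanSpace.inner_single_right] using hcl hvertex
    · have hvertex : (0 : E n) ∈ truncatedSimplex n 0 := by simp [truncatedSimplex]
      simpa using hcl hvertex
  · rintro ⟨hj, h0⟩ x hx
    have hsum : ∑ i, x i * (ξ i - inner ℝ ξ p) ≤ ∑ i, x i * 1 :=
      Finset.sum_le_sum fun i _ => mul_le_mul_of_nonneg_left (hj i) (hx.1 i).le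
    simp only [mul_sub, Finset.sum_sub_distrib, ← Finset.sum_mul, mul_one, ← hinner] at hsum
    rw [inner_sub_right]
    nlinarith [hx.2]

/-- The matrix `diag(p) - p pᵀ`. Since it sends `ξ` to `(p_j (ξ_j - ⟨ξ, p⟩))_j`, the map
`ξ ↦ p - polarMatrix p *ᵥ ξ` takes the polar of the standard simplex at `p` to the closed standard
simplex. -/
def polarMatrix {n : ℕ} (p : E n) : Matrix (Fin n) (Fin n) ℝ :=
  Matrix.diagonal p.ofLp - Matrix.vecMulVec p.ofLp p.ofLp

lemma det_polarMatrix {n : ℕ} (p : E n) :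
    (polarMatrix p).det = (1 - ∑ i, p i) * ∏ i, p i := by
  have hfactor : polarMatrix p = Matrix.diagonal p.ofLp *
      (1 + Matrix.replicateCol Unit (fun _ : Fin n => (-1 : ℝ)) *
        Matrix.replicateRow Unit p.ofLp) := by
    ext i j
    rw [Matrix.diagonal_mul, polarMatrix, Matrix.sub_apply, Matrix.vecMulVec_apply]
    rcases eq_or_ne i j with rfl | hij
    · simp [Matrix.mul_apply, mul_add, sub_eq_add_neg]
    · simp [Matrix.mul_apply, hij]
  rw [hfactor, Matrix.det_mul, Matrix.det_diagonal,
    Matrix.det_one_add_replicateCol_mul_replicateRow, mul_comm]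
  simp [dotProduct, sub_eq_add_neg]

lemma toEuclideanLin_polarMatrix_apply {n : ℕ} (p ξ : E n) (j : Fin n) :
    Matrix.toEuclideanLin (polarMatrix p) ξ j = p j * (ξ j - inner ℝ ξ p) := by
  simp [polarMatrix, Matrix.toLpLin_apply, Matrix.mulVec_diagonal,
    Matrix.vecMulVec_mulVec, PiLp.inner_apply, dotProduct, mul_sub]

lemma polarAt_stdSimplex_eq_preimage {n : ℕ} {p : E n} (hp : p ∈ stdSimplex n) :
    polarAt (stdSimplex n) p = Matrix.toEuclideanLin (polarMatrix p) ⁻¹'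
      ((fun x => p - x) ⁻¹' truncatedSimplex n 0) := by
  have hlast : 0 < 1 - ∑ i, p i := sub_pos.2 hp.2
  rw [polarAt_stdSimplex]
  ext ξ
  have hinner : ∑ i, p i * ξ i = inner ℝ ξ p := by simp [PiLp.inner_apply]
  simp only [Set.mem_preimage, Set.mem_ofPred_eq, truncatedSimplex, PiLp.sub_apply,
    toEuclideanLin_polarMatrix_apply]
  refine and_congr (forall_congr' fun j => ?_) ?_
  · rw [← sub_nonneg, ← mul_nonneg_iff_of_pos_left (hp.1 j), mul_sub, mul_one]
  · rw [← sub_nonneg, ← mul_nonneg_iff_of_pos_left hlast]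
    simp only [mul_sub, Finset.sum_sub_distrib, ← Finset.sum_mul, hinner]
    ring_nf

lemma volume_polarAt_stdSimplex {n : ℕ} {p : E n} (hp : p ∈ stdSimplex n) :
    volume (polarAt (stdSimplex n) p) =
      ENNReal.ofReal (1 / n.factorial) * ENNReal.ofReal (1 / ((1 - ∑ i, p i) * ∏ i, p i)) := by
  have hpos : 0 < (1 - ∑ i, p i) * ∏ i, p i :=
    mul_pos (sub_pos.2 hp.2) (Finset.prod_pos fun i _ => hp.1 i)
  have hdet : LinearMap.det (Matrix.toEuclideanLin (polarMatrix p)) =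
      (1 - ∑ i, p i) * ∏ i, p i := by
    rw [Matrix.toEuclideanLin, Matrix.toLpLin_eq_toLin, LinearMap.det_toLin, det_polarMatrix]
  have hreflect : volume ((fun x => p - x) ⁻¹' truncatedSimplex n 0) =
      volume (truncatedSimplex n 0) :=
    (Measure.measurePreserving_sub_left volume p).measure_preimage
      (measurableSet_truncatedSimplex n 0).nullMeasurableSet
  rw [polarAt_stdSimplex_eq_preimage hp,
    Measure.addHaar_preimage_linearMap _ (hdet ▸ hpos.ne'), hreflect,
    volume_truncatedSimplex_zero, hdet, abs_of_pos (inv_pos.2 hpos), one_div (_ * _), mul_comm]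

/-! ### Affine invariance of the Funk geometry -/

lemma det_adjoint {𝕜 F : Type*} [RCLike 𝕜] [NormedAddCommGroup F] [InnerProductSpace 𝕜 F]
    [FiniteDimensional 𝕜 F] (L : F →ₗ[𝕜] F) :
    LinearMap.det (LinearMap.adjoint L) = star (LinearMap.det L) := by
  rw [← LinearMap.det_toMatrix (stdOrthonormalBasis 𝕜 F).toBasis,
    ← LinearMap.det_toMatrix (stdOrthonormalBasis 𝕜 F).toBasis L, LinearMap.toMatrix_adjoint,
    Matrix.det_conjTranspose]

section AffineInvariance

variable {n : ℕ} (K : Set (E n)) (e : E n ≃ᴬ[ℝ] E n)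

lemma funkBall_image {K} (hc : Convex ℝ K) (ho : IsOpen K) (hb : Bornology.IsBounded K) {p : E n}
    (hp : p ∈ K) {R : ℝ} (hR : 0 < R) : funkBall (e '' K) (e p) R = e '' funkBall K p R := by
  have hc' : Convex ℝ (e '' K) := hc.affine_image (e : E n →ᵃ[ℝ] E n)
  have hb' : Bornology.IsBounded (e '' K) :=
    (hb.isCompact_closure.image e.continuous).isBounded.subset (Set.image_mono subset_closure)
  have hhom (x : E n) : AffineMap.homothety (e p) (1 - Real.exp (-R)) (e x) =
      e (AffineMap.homothety p (1 - Real.exp (-R)) x) := by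
    simp only [AffineMap.homothety_eq_lineMap]
    exact ((e : E n →ᵃ[ℝ] E n).apply_lineMap p x _).symm
  rw [funkBall_eq_image_homothety hc' (e.toHomeomorph.isOpenMap K ho)
    (Set.mem_image_of_mem e hp) hb' hR, funkBall_eq_image_homothety hc ho hp hb hR]
  have hclosure : closure (e '' K) = e '' closure K := (e.toHomeomorph.image_closure K).symm
  simp only [hclosure, Set.image_image, hhom]

lemma volume_polarAt_image (p : E n) : volume (polarAt (e '' K) (e p)) =
    ENNReal.ofReal |LinearMap.det (e.linear : E n →ₗ[ℝ] E n)|⁻¹ * volume (polarAt K p) := by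
  have hset : polarAt (e '' K) (e p) =
      LinearMap.adjoint (e.linear : E n →ₗ[ℝ] E n) ⁻¹' polarAt K p := by
    ext ξ
    simp only [polarAt, Set.forall_mem_image, Set.mem_preimage]
    refine forall₂_congr fun x hx => ?_
    rw [LinearMap.adjoint_inner_left]
    exact Iff.of_eq (congrArg (inner ℝ ξ · ≤ 1) ((e : E n →ᵃ[ℝ] E n).linearMap_vsub x p).symm)
  have hdet : LinearMap.det (e.linear : E n →ₗ[ℝ] E n) ≠ 0 := (LinearEquiv.isUnit_det' _).ne_zero
  have hdet' := det_adjoint (e.linear : E n →ₗ[ℝ] E n)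
  rw [star_trivial] at hdet'
  rw [hset, Measure.addHaar_preimage_linearMap _ (hdet' ▸ hdet), hdet', abs_inv]

lemma holmesThompson_image {U : Set (E n)} (hU : MeasurableSet U) :
    holmesThompson (e '' K) (e '' U) = holmesThompson K U := by
  have hdet : 0 < |LinearMap.det (e.linear : E n →ₗ[ℝ] E n)| :=
    abs_pos.2 (LinearEquiv.isUnit_det' _).ne_zero
  unfold holmesThompson
  have hderiv : ∀ x ∈ U, HasFDerivWithinAt e e.toContinuousAffineMap.contLinear U x :=
    fun _ _ => e.toContinuousAffineMap.hasFDerivWithinAt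
  rw [lintegral_image_eq_lintegral_abs_det_fderiv_mul volume hU hderiv e.injective.injOn]
  refine setLIntegral_congr_fun hU fun p _ => ?_
  have hlinear : e.toContinuousAffineMap.contLinear.det =
      LinearMap.det (e.linear : E n →ₗ[ℝ] E n) := rfl
  rw [volume_polarAt_image, hlinear, ENNReal.div_eq_inv_mul, ENNReal.div_eq_inv_mul,
    mul_left_comm, ← mul_assoc (ENNReal.ofReal _), ← ENNReal.ofReal_mul hdet.le,
    mul_inv_cancel₀ hdet.ne', ENNReal.ofReal_one, one_mul]

end AffineInvariance

/-! ### Simplices as affine images of the standard simplex -/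

section Simplex

variable {n : ℕ} (s : Affine.Simplex ℝ (E n) n)

lemma linearIndependent_edges :
    LinearIndependent ℝ fun i : Fin n => s.points i.succ - s.points 0 := by
  have h := (affineIndependent_iff_linearIndependent_vsub ℝ s.points 0).1 s.independent
  exact h.comp (fun i : Fin n => (⟨i.succ, Fin.succ_ne_zero i⟩ : {j : Fin (n + 1) // j ≠ 0}))
    fun i j hij => Fin.succ_injective n (Subtype.ext_iff.1 hij)

/-- The basis of `ℝⁿ` formed by the edges of `s` at its vertex `0`. -/
def edgeBasis : Module.Basis (Fin n) ℝ (E n) :=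
  .mk (linearIndependent_edges s)
    ((linearIndependent_edges s).span_eq_top_of_card_eq_finrank' (by simp)).ge

/-- The affine automorphism of `ℝⁿ` that maps the vertices `0, e_1, …, e_n` of the standard simplex
to those of `s`. -/
def simplexEquiv : E n ≃ᴬ[ℝ] E n :=
  ((WithLp.linearEquiv 2 ℝ (Fin n → ℝ)).trans
    (edgeBasis s).equivFun.symm).toContinuousLinearEquiv.toContinuousAffineEquiv.trans
    (ContinuousAffineEquiv.vaddConst ℝ (s.points 0))

lemma simplexEquiv_apply (x : E n) :
    simplexEquiv s x = ∑ i, x i • (s.points i.succ - s.points 0) + s.points 0 := by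
  simp [simplexEquiv, edgeBasis, Module.Basis.equivFun_symm_apply]

lemma affineCombination_eq_simplexEquiv {w : Fin (n + 1) → ℝ} (hw : ∑ i, w i = 1) :
    Finset.univ.affineCombination ℝ s.points w =
      simplexEquiv s (WithLp.toLp 2 fun i => w i.succ) := by
  rw [Finset.affineCombination_eq_weightedVSubOfPoint_vadd_of_sum_eq_one _ _ _ hw (s.points 0),
    Finset.weightedVSubOfPoint_apply, Fin.sum_univ_succ, simplexEquiv_apply]
  simp

lemma interior_eq_image_stdSimplex (hn : 1 ≤ n) :
    s.interior = simplexEquiv s '' stdSimplex n := by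
  ext z
  constructor
  · rintro ⟨w, hw, hmem, rfl⟩
    rw [affineCombination_eq_simplexEquiv s hw]
    rw [Fin.sum_univ_succ] at hw
    exact Set.mem_image_of_mem _ ⟨fun i => (hmem i.succ).1, by linarith [(hmem 0).1]⟩
  · rintro ⟨x, hx, rfl⟩
    have : Nonempty (Fin n) := ⟨⟨0, hn⟩⟩
    have hsum : ∑ i, (Fin.cons (1 - ∑ i, x i) x.ofLp : Fin (n + 1) → ℝ) i = 1 := by
      simp [Fin.sum_univ_succ]
    refine ⟨Fin.cons (1 - ∑ i, x i) x.ofLp, hsum, fun i => ?_, ?_⟩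
    · induction i using Fin.cases with
      | zero =>
        have hpos : 0 < ∑ i, x i := Finset.sum_pos (fun i _ => hx.1 i) Finset.univ_nonempty
        exact ⟨sub_pos.2 hx.2, sub_lt_self 1 hpos⟩
      | succ i =>
        exact ⟨hx.1 i, (Finset.single_le_sum (fun j _ => (hx.1 j).le)
          (Finset.mem_univ i)).trans_lt hx.2⟩
    · simp [affineCombination_eq_simplexEquiv s hsum]

lemma centroid_eq_simplexEquiv :
    Finset.univ.centroid ℝ s.points = simplexEquiv s (stdBarycenter n) := by
  rw [Finset.centroid_def, affineCombination_eq_simplexEquiv]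
  · congr 1
    ext i
    simp [stdBarycenter]
  · exact Finset.sum_centroidWeights_eq_one_of_card_ne_zero ℝ _ (by simp)

lemma holmesThompson_simplex (hn : 1 ≤ n) {R : ℝ} (hR : 0 < R) :
    holmesThompson s.interior (funkBall s.interior (Finset.univ.centroid ℝ s.points) R) =
      holmesThompson (stdSimplex n) (simplexBall n R) := by
  rw [interior_eq_image_stdSimplex s hn, centroid_eq_simplexEquiv,
    funkBall_image _ (convex_stdSimplex n) (isOpen_stdSimplex n) (isBounded_stdSimplex n)
      (stdBarycenter_mem n) hR, ← simplexBall, simplexBall_eq_truncatedSimplex n hR,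
    holmesThompson_image _ _ (measurableSet_truncatedSimplex n _)]

end Simplex

/-! ### The volume of the Funk balls of the standard simplex -/

lemma unitBallVolume_ne_zero (n : ℕ) : unitBallVolume n ≠ 0 :=
  (Metric.measure_ball_pos volume _ one_pos).ne'

lemma unitBallVolume_ne_top (n : ℕ) : unitBallVolume n ≠ ⊤ :=
  measure_ball_lt_top.ne

lemma profile_excess_nonneg (n : ℕ) {R : ℝ} (hR : 0 < R) : 0 ≤ profile n (excess n R) :=
  profile_nonneg n (excess_pos n hR).le

lemma setLIntegral_simplexBall_one_div_prod (n : ℕ) {R : ℝ} (hR : 0 < R) :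
    ∫⁻ x in simplexBall n R, ENNReal.ofReal (1 / ∏ i, x i) =
      ENNReal.ofReal (profile n (excess n R)) := by
  have hc : 0 < Real.exp (-R) / ((n : ℝ) + 1) := by positivity
  have hle : ((n : ℝ) + 1) * (Real.exp (-R) / (n + 1)) ≤ 1 := by
    rw [mul_div_cancel₀ _ (by positivity)]
    exact Real.exp_le_one_iff.2 (neg_nonpos.2 hR.le)
  have hexcess : 1 / (Real.exp (-R) / ((n : ℝ) + 1)) - (n + 1) = excess n R := by
    rw [one_div_div, Real.exp_neg, div_inv_eq_mul, excess]
    ring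
  rw [simplexBall_eq_truncatedSimplex n hR, setLIntegral_one_div_prod hc,
    iterConv_truncInv_step hc n hle, hexcess]

lemma unitBallVolume_mul_holmesThompson {n : ℕ} (K U : Set (E n)) :
    unitBallVolume n * holmesThompson K U = ∫⁻ p in U, volume (polarAt K p) := by
  simp only [holmesThompson, ENNReal.div_eq_inv_mul]
  rw [lintegral_const_mul' _ _ (ENNReal.inv_ne_top.2 (unitBallVolume_ne_zero n)), ← mul_assoc,
    ENNReal.mul_inv_cancel (unitBallVolume_ne_zero n) (unitBallVolume_ne_top n), one_mul]

lemma setLIntegral_simplexBall_volume_polarAt (n : ℕ) {R : ℝ} (hR : 0 < R) :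
    ∫⁻ p in simplexBall n R, volume (polarAt (stdSimplex n) p) =
      ENNReal.ofReal (((n : ℝ) + 1) / n.factorial * profile n (excess n R)) := by
  have hc : 0 < Real.exp (-R) / ((n : ℝ) + 1) := by positivity
  have hball := simplexBall_eq_truncatedSimplex n hR
  calc ∫⁻ p in simplexBall n R, volume (polarAt (stdSimplex n) p)
      = ∫⁻ p in simplexBall n R, ENNReal.ofReal (1 / n.factorial) *
          ENNReal.ofReal (1 / ((1 - ∑ i, p i) * ∏ i, p i)) := by
        rw [hball]
        exact setLIntegral_congr_fun (measurableSet_truncatedSimplex n _) fun p hp =>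
          volume_polarAt_stdSimplex (truncatedSimplex_subset_stdSimplex n hc hp)
    _ = ENNReal.ofReal (1 / n.factorial) *
          ((n + 1) * ∫⁻ p in simplexBall n R, ENNReal.ofReal (1 / ∏ i, p i)) := by
        rw [lintegral_const_mul' _ _ ENNReal.ofReal_ne_top, hball,
          setLIntegral_one_div_prod_barycentric hc]
    _ = ENNReal.ofReal (((n : ℝ) + 1) / n.factorial * profile n (excess n R)) := by
        rw [setLIntegral_simplexBall_one_div_prod n hR, ← ENNReal.ofReal_natCast,
          ← ENNReal.ofReal_one, ← ENNReal.ofReal_add (by positivity) zero_le_one,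
          ← ENNReal.ofReal_mul (by positivity), ← ENNReal.ofReal_mul (by positivity)]
        ring_nf

lemma simplexVolume_eq_profile (n : ℕ) {R : ℝ} (hR : 0 < R) :
    simplexVolume n R = ((n : ℝ) + 1) / n.factorial * profile n (excess n R) := by
  have := profile_excess_nonneg n hR
  rw [simplexVolume, unitBallVolume_mul_holmesThompson,
    setLIntegral_simplexBall_volume_polarAt n hR, ENNReal.toReal_ofReal (by positivity)]

lemma holmesThompson_simplexBall (n : ℕ) {R : ℝ} (hR : 0 < R) :
    holmesThompson (stdSimplex n) (simplexBall n R) =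
      ENNReal.ofReal (simplexVolume n R) / unitBallVolume n := by
  rw [simplexVolume_eq_profile n hR, ← setLIntegral_simplexBall_volume_polarAt n hR,
    ← unitBallVolume_mul_holmesThompson,
    ENNReal.eq_div_iff (unitBallVolume_ne_zero n) (unitBallVolume_ne_top n)]

lemma one_div_prod_nonneg_ae_simplexBall (n : ℕ) (R : ℝ) :
    0 ≤ᵐ[volume.restrict (simplexBall n R)] fun x : E n => 1 / ∏ i, x i := by
  refine ae_restrict_of_ae_restrict_of_subset (fun _ hx => hx.1 : simplexBall n R ⊆ stdSimplex n) ?_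
  filter_upwards [ae_restrict_mem (isOpen_stdSimplex n).measurableSet] with x hx
  exact one_div_nonneg.2 (Finset.prod_nonneg fun i _ => (hx.1 i).le)

lemma integrableOn_one_div_prod (n : ℕ) {R : ℝ} (hR : 0 < R) :
    IntegrableOn (fun x : E n => 1 / ∏ i, x i) (simplexBall n R) := by
  refine ⟨(by fun_prop : Measurable _).aestronglyMeasurable, ?_⟩
  rw [hasFiniteIntegral_iff_ofReal (one_div_prod_nonneg_ae_simplexBall n R),
    setLIntegral_simplexBall_one_div_prod n hR]
  exact ENNReal.ofReal_lt_top

lemma simplexVolume_eq_integral (n : ℕ) {R : ℝ} (hR : 0 < R) :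
    simplexVolume n R = ((n : ℝ) + 1) / n.factorial * ∫ x in simplexBall n R, 1 / ∏ i, x i := by
  rw [simplexVolume_eq_profile n hR,
    integral_eq_lintegral_of_nonneg_ae (one_div_prod_nonneg_ae_simplexBall n R)
      (integrableOn_one_div_prod n hR).aestronglyMeasurable,
    setLIntegral_simplexBall_one_div_prod n hR, ENNReal.toReal_ofReal (profile_excess_nonneg n hR)]

lemma hasDerivAt_simplexVolume {n : ℕ} (hn : 2 ≤ n) {R : ℝ} (hR : 0 < R) :
    HasDerivAt (simplexVolume n)
      (((n : ℝ) + 1) / n * (1 / (1 - Real.exp (-R) / ((n : ℝ) + 1))) *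
        simplexVolume (n - 1)
          (R + Real.log (1 + 1 / (n : ℝ) - 1 / (n : ℝ) * Real.exp (-R)))) R := by
  obtain ⟨m, rfl⟩ : ∃ m, n = m + 1 := ⟨n - 1, by omega⟩
  have hvolume : simplexVolume (m + 1) =ᶠ[𝓝 R] fun r =>
      (((m + 1 : ℕ) : ℝ) + 1) / (m + 1).factorial * profile (m + 1) (excess (m + 1) r) := by
    filter_upwards [lt_mem_nhds hR] with r hr using simplexVolume_eq_profile (m + 1) hr
  have hradius : R + Real.log (1 + 1 / ((m + 1 : ℕ) : ℝ) - 1 / ((m + 1 : ℕ) : ℝ) * Real.exp (-R)) =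
      shiftedRadius m R := by
    rw [shiftedRadius, Nat.cast_succ]
  refine (((hasDerivAt_profile_excess m hR).const_mul _).congr_of_eventuallyEq
    hvolume).congr_deriv ?_
  rw [Nat.add_sub_cancel, hradius, simplexVolume_eq_profile m (shiftedRadius_pos m hR),
    Nat.factorial_succ]
  push_cast
  have htwo : (m : ℝ) + 1 + 1 = m + 2 := by ring
  rw [htwo]
  field_simp

lemma exists_simplexVolume_eq_atTop {n : ℕ} (hn : 1 ≤ n) :
    ∃ ε : ℝ → ℝ, ε =o[atTop] (fun R : ℝ => R⁻¹) ∧ ∀ R : ℝ, 0 < R →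
      simplexVolume n R = ((n + 1).factorial : ℝ) / (n.factorial : ℝ) ^ 2 * R ^ n *
          (1 + n * Real.log ((n : ℝ) + 1) * R⁻¹ + ε R) := by
  have hpow {R : ℝ} (hR : 0 < R) : R ^ (n - 1) = R ^ n * R⁻¹ := by
    rw [pow_sub₀ R hR.ne' hn, pow_one]
  refine ⟨fun R => (profile n (excess n R) - R ^ n - n * R ^ (n - 1) * Real.log (n + 1)) *
    (R ^ n)⁻¹, ?_, fun R hR => ?_⟩
  · refine ((profile_excess_isLittleO_atTop hn).mul_isBigO
      (isBigO_refl (fun R : ℝ => (R ^ n)⁻¹) atTop)).congr' EventuallyEq.rfl ?_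
    filter_upwards [eventually_gt_atTop 0] with R hR
    rw [hpow hR]
    field_simp
  · simp only [simplexVolume_eq_profile n hR, hpow hR, Nat.factorial_succ]
    push_cast
    field_simp
    ring

lemma exists_simplexVolume_eq_nhdsGT_zero (n : ℕ) :
    ∃ ε : ℝ → ℝ, ε =o[𝓝[>] 0] (fun R : ℝ => R ^ (n + 1)) ∧ ∀ R : ℝ, 0 < R →
      simplexVolume n R = ((n : ℝ) + 1) ^ (n + 1) / (n.factorial : ℝ) ^ 2 *
          (R ^ n - (n : ℝ) / 2 * R ^ (n + 1) + ε R) := by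
  refine ⟨_, profile_excess_isLittleO_nhdsGT_zero n, fun R hR => ?_⟩
  rw [simplexVolume_eq_profile n hR, add_sub_cancel]
  field_simp
  ring

end FunkSimplex

end

theorem mainTheorem8 (n : ℕ) (hn : 1 ≤ n) :
    -- the volume of the ball in the Funk geometry of any `n`-simplex
    (∀ (s : Affine.Simplex ℝ (FunkSimplex.E n) n) (R : ℝ), 0 < R →
      FunkSimplex.holmesThompson s.interior
          (FunkSimplex.funkBall s.interior (Finset.univ.centroid ℝ s.points) R) =
        ENNReal.ofReal (FunkSimplex.simplexVolume n R) / FunkSimplex.unitBallVolume n) ∧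
    -- the same for the standard simplex, and the integral formula
    (∀ R : ℝ, 0 < R →
      FunkSimplex.holmesThompson (FunkSimplex.stdSimplex n) (FunkSimplex.simplexBall n R) =
        ENNReal.ofReal (FunkSimplex.simplexVolume n R) / FunkSimplex.unitBallVolume n ∧
      IntegrableOn (fun x : FunkSimplex.E n => 1 / ∏ i, x i) (FunkSimplex.simplexBall n R) ∧
      FunkSimplex.simplexVolume n R =
        ((n : ℝ) + 1) / (n.factorial : ℝ) *
          ∫ x in FunkSimplex.simplexBall n R, 1 / ∏ i, x i) ∧
    -- the recursive differential equation
    (2 ≤ n → ∀ R : ℝ, 0 < R →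
      HasDerivAt (FunkSimplex.simplexVolume n)
        (((n : ℝ) + 1) / n * (1 / (1 - Real.exp (-R) / ((n : ℝ) + 1))) *
          FunkSimplex.simplexVolume (n - 1)
            (R + Real.log (1 + 1 / (n : ℝ) - 1 / (n : ℝ) * Real.exp (-R)))) R) ∧
    -- the asymptotics for large radii
    (∃ ε : ℝ → ℝ, ε =o[atTop] (fun R : ℝ => R⁻¹) ∧ ∀ R : ℝ, 0 < R →
      FunkSimplex.simplexVolume n R =
        ((n + 1).factorial : ℝ) / (n.factorial : ℝ) ^ 2 * R ^ n *
          (1 + n * Real.log ((n : ℝ) + 1) * R⁻¹ + ε R)) ∧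
    -- the asymptotics for small radii
    (∃ ε : ℝ → ℝ, ε =o[𝓝[>] 0] (fun R : ℝ => R ^ (n + 1)) ∧ ∀ R : ℝ, 0 < R →
      FunkSimplex.simplexVolume n R =
        ((n : ℝ) + 1) ^ (n + 1) / (n.factorial : ℝ) ^ 2 *
          (R ^ n - (n : ℝ) / 2 * R ^ (n + 1) + ε R)) := by
  exact ⟨fun s R hR => (FunkSimplex.holmesThompson_simplex s hn hR).trans
      (FunkSimplex.holmesThompson_simplexBall n hR),
    fun R hR => ⟨FunkSimplex.holmesThompson_simplexBall n hR,
      FunkSimplex.integrableOn_one_div_prod n hR, FunkSimplex.simplexVolume_eq_integral n hR⟩,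
    fun hn2 R hR => FunkSimplex.hasDerivAt_simplexVolume hn2 hR,
    FunkSimplex.exists_simplexVolume_eq_atTop hn, FunkSimplex.exists_simplexVolume_eq_nhdsGT_zero n⟩
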